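/- **Setting.** Let $r>0$; let $\mu,\phi:\mathbb R\to\mathbb R$ be locally Lipschitz with linear growth, $\phi>0$, and let $\mathcal L f=\mu f'+\tfrac12\phi^2f''$ be the generator of the private state $dz_t=\mu(z_t)\,dt+\phi(z_t)\,dW_t$. Let $\pi:\mathbb R\to\mathbb R$ be continuous, $\bar\lambda>0$, and let $k:[0,\bar\lambda]\to\mathbb R$ be convex, $C^1$ and nondecreasing with $k(0)=0$. Fix reset costs $0\le K_1<K_2$, reset targets $z_1^*,z_2^*\in\mathbb R$ and a window centre $\hat z\in\mathbb R$, and put $$(\mathcal MV)(z)=\max\{V(z_1^*)-K_1,\;V(z_2^*)-K_2\},\qquad \lambda_\delta(z)=\begin{cases}0,&|z-\hat z|\le\delta,\\ \bar\lambda,&|z-\hat z|>\delta,\end{cases}\qquad \delta\ge0 .$$ For $\delta\ge0$ consider the quasi-variational inequality $$(\mathrm{QVI}_\delta)\qquad \min\bigl\{\,rV-\mathcal LV-\pi+k(\lambda_\delta),\;V-\mathcal MV\,\bigr\}=0\quad\text{on }\mathbb R .$$ Since the martingale part of public beliefs has quadratic variation proportional to the publication intensity, it is suppressed exactly where $\lambda_\delta=0$;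 the case $\delta=0$, in which the silence window has shrunk to $\{\hat z\}$, is the *reduced-form* QVI. Viscosity subsolutions (upper semicontinuous), supersolutions (lower semicontinuous) and solutions (both) of $(\mathrm{QVI}_\delta)$ are understood in the usual sense for discontinuous equations: with $C^2$ test functions, and with the running cost $k(\lambda_\delta)$ replaced by its lower semicontinuous envelope for subsolutions and by its upper semicontinuous envelope for supersolutions. For $\rho\ge0$ let $\mathcal G_\rho$ be the class of $u:\mathbb R\to\mathbb R$ with $|u(z)|\le Ce^{\rho|z|}$ for all $z$ and some constant $C$. **Corollary (viscosity stability of the reduced form).** Fix $\rho\ge0$. For all sufficiently small $\delta>0$ let $V^\delta\in\mathcal G_\rho$ be a viscosity solution of $(\mathrm{QVI}_\delta)$. Assume the comparison principle for the limit problem: whenever $u,v\in\mathcal G_\rho$ are respectively a viscosity subsolution and a viscosity supersolution of $(\mathrm{QVI}_0)$, then $u\le v$ on $\mathbb R$. Then there is a function $V^0\in\mathcal G_\rho$ such that $V^\delta\to V^0$ locally uniformly on $\mathbb R$ as $\delta\downarrow0$, and $V^0$ is the unique viscosity solution of the reduced-form inequality $(\mathrm{QVI}_0)$ in $\mathcal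 G_\rho$. -/

import Mathlib

open Filter Topology

/-- Primitives of the two-reset impulse control problem with a publication clock, together with
the standing assumptions on them.  The private state is the one-dimensional diffusion
`dz = μ(z) dt + φ(z) dW`. -/
structure ClockModel where
  /-- discount rate -/
  r : ℝ
  /-- drift of the private state -/
  μ : ℝ → ℝ
  /-- diffusion coefficient of the private state -/
  φ : ℝ → ℝ
  /-- flow payoff -/
  π : ℝ → ℝ
  /-- flow cost of publication intensity -/
  k : ℝ → ℝ
  /-- maximal publication intensity -/
  lamBar : ℝ
  /-- fixed cost of a patch -/
  K₁ : ℝ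
  /-- fixed cost of a pivot -/
  K₂ : ℝ
  /-- target of a patch -/
  z₁ : ℝ
  /-- target of a pivot -/
  z₂ : ℝ
  /-- centre of the silence window -/
  zHat : ℝ
  r_pos : 0 < r
  μ_lip : LocallyLipschitz μ
  μ_growth : ∃ C : ℝ, ∀ z, |μ z| ≤ C * (1 + |z|)
  φ_lip : LocallyLipschitz φ
  φ_growth : ∃ C : ℝ, ∀ z, |φ z| ≤ C * (1 + |z|)
  φ_pos : ∀ z, 0 < φ z
  π_cont : Continuous π
  lamBar_pos : 0 < lamBar
  k_zero : k 0 = 0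
  k_convex : ConvexOn ℝ (Set.Icc 0 lamBar) k
  k_contDiff : ContDiffOn ℝ 1 k (Set.Icc 0 lamBar)
  k_mono : MonotoneOn k (Set.Icc 0 lamBar)
  K₁_nonneg : 0 ≤ K₁
  K₁_lt_K₂ : K₁ < K₂

namespace ClockModel

/-- The posted publication policy `λ_δ`: the clock is off on the window `|z - ẑ| ≤ δ` and runs at
the maximal intensity elsewhere.  For `δ = 0` the window has shrunk to the single point `ẑ`. -/
noncomputable def silencePolicy (P : ClockModel) (δ z : ℝ) : ℝ :=
  if |z - P.zHat| ≤ δ then 0 else P.lamBar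

/-- The flow cost `k(λ_δ(z))` of the posted policy. -/
noncomputable def clockCost (P : ClockModel) (δ z : ℝ) : ℝ :=
  P.k (P.silencePolicy δ z)

/-- Infinitesimal generator of the private state, `μ f' + ½ φ² f''`. -/
noncomputable def generator (P : ClockModel) (f : ℝ → ℝ) (z : ℝ) : ℝ :=
  P.μ z * deriv f z + 1 / 2 * P.φ z ^ 2 * deriv (deriv f) z

/-- The impulse operator; its value does not depend on the pre-impulse state. -/
noncomputable def impulse (P : ClockModel) (u : ℝ → ℝ) (_z : ℝ) : ℝ :=
  max (u P.z₁ - P.K₁) (u P.z₂ - P.K₂)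

end ClockModel

/-- Lower semicontinuous envelope of a locally bounded function
(the neighbourhood filter contains the point itself). -/
noncomputable def lowerEnvelope (c : ℝ → ℝ) (z : ℝ) : ℝ := liminf c (𝓝 z)

/-- Upper semicontinuous envelope of a locally bounded function. -/
noncomputable def upperEnvelope (c : ℝ → ℝ) (z : ℝ) : ℝ := limsup c (𝓝 z)

namespace ClockModel

/-- Viscosity subsolution of the quasi-variational inequality
`min {r V - L V - π + k(λ_δ), V - M V} = 0` on the real line.  The running cost is discontinuous,
so, as usual, it enters through its lower envelope. -/
structure IsViscositySubsolution (P : ClockModel) (δ : ℝ) (u : ℝ → ℝ) : Prop where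
  usc : UpperSemicontinuous u
  ineq : ∀ f : ℝ → ℝ, ContDiff ℝ 2 f → ∀ z : ℝ, IsLocalMax (fun y => u y - f y) z →
    min (P.r * u z - P.generator f z - P.π z + lowerEnvelope (P.clockCost δ) z)
      (u z - P.impulse u z) ≤ 0

/-- Viscosity supersolution of the same quasi-variational inequality; the running cost enters
through its upper envelope. -/
structure IsViscositySupersolution (P : ClockModel) (δ : ℝ) (v : ℝ → ℝ) : Prop where
  lsc : LowerSemicontinuous v
  ineq : ∀ f : ℝ → ℝ, ContDiff ℝ 2 f → ∀ z : ℝ, IsLocalMin (fun y => v y - f y) z →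
    0 ≤ min (P.r * v z - P.generator f z - P.π z + upperEnvelope (P.clockCost δ) z)
      (v z - P.impulse v z)

/-- (Continuous) viscosity solution of the quasi-variational inequality with running payoff
`π - k(λ_δ)`.  The case `δ = 0` is the reduced-form inequality, in which the clock is off
exactly on the vanished window `{ẑ}`. -/
def IsViscositySolution (P : ClockModel) (δ : ℝ) (V : ℝ → ℝ) : Prop :=
  P.IsViscositySubsolution δ V ∧ P.IsViscositySupersolution δ V

end ClockModel

/-- The growth class `|u(z)| ≤ C exp(ρ |z|)`; for `ρ = 0` these are the bounded functions. -/
def HasExpGrowth (ρ : ℝ) (u : ℝ → ℝ) : Prop :=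
  ∃ C : ℝ, ∀ z : ℝ, |u z| ≤ C * Real.exp (ρ * |z|)

/-- Comparison principle, in the growth class of rate `ρ`, for the quasi-variational inequality
with running payoff `π - k(λ_δ)`. -/
def ClockModel.ComparisonPrinciple (P : ClockModel) (δ ρ : ℝ) : Prop :=
  ∀ u v : ℝ → ℝ, P.IsViscositySubsolution δ u → HasExpGrowth ρ u →
    P.IsViscositySupersolution δ v → HasExpGrowth ρ v → ∀ z, u z ≤ v z

/-! This is the Barles–Perthame method of half-relaxed limits. The running cost always lies in `[0,
k(λ̄)]`, and for `δ = 0` its upper envelope is `k(λ̄)` everywhere, since a one-point window is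
negligible. So each `V^δ` is already a supersolution of the limit problem, and `V^δ - k(λ̄)/r` is a
subsolution. Comparison then shows that any two of the `V^δ` differ by at most `k(λ̄)/r`, which
bounds the family uniformly in `G_ρ` (`exists_uniform_bound`).

The upper and lower half-relaxed limits therefore exist in `G_ρ`, and they are a subsolution and a
supersolution of the limit problem (`isViscositySubsolution_of_relaxedLimit`,
`isViscositySupersolution_of_relaxedLimit`). Comparison orders the upper limit below the lower one.
The reverse order is automatic, so they coincide, which forces local uniform convergence. Uniqueness
is comparison again. -/

/-- `W` is the upper half-relaxed limit of the family `w` along `l`: it is the smallest function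
dominating the family asymptotically, uniformly near every point. -/
structure IsUpperRelaxedLimit {ι : Type*} (l : Filter ι) (w : ι → ℝ → ℝ) (W : ℝ → ℝ) : Prop where
  eventually_lt : ∀ z c, W z < c → ∀ᶠ p in l ×ˢ 𝓝 z, w p.1 p.2 < c
  frequently_lt : ∀ z c, c < W z → ∃ᶠ p in l ×ˢ 𝓝 z, c < w p.1 p.2

/-- A family with a continuous bound has an upper half-relaxed limit with the same bound. -/
theorem exists_isUpperRelaxedLimit {ι : Type*} {l : Filter ι} [l.NeBot] {w : ι → ℝ → ℝ}
    {B : ℝ → ℝ} (hB : Continuous B) (hw : ∀ᶠ i in l, ∀ y, |w i y| ≤ B y) :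
    ∃ W, IsUpperRelaxedLimit l w W ∧ ∀ z, |W z| ≤ B z := by
  have key : ∀ z c, B z < c → ∀ᶠ p in l ×ˢ 𝓝 z, |w p.1 p.2| ≤ c := by
    intro z c hc
    filter_upwards [tendsto_fst.eventually hw,
      tendsto_snd.eventually (hB.continuousAt.eventually_lt_const hc)] with p h1 h2
    exact (h1 p.2).trans h2.le
  have hbdd : ∀ z, IsBoundedUnder (· ≤ ·) (l ×ˢ 𝓝 z) (fun p : ι × ℝ => w p.1 p.2) := fun z =>
    ⟨B z + 1, eventually_map.2 <| (key z _ (lt_add_one _)).mono fun p h => (abs_le.1 h).2⟩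
  have hcob : ∀ z, IsCoboundedUnder (· ≤ ·) (l ×ˢ 𝓝 z) (fun p : ι × ℝ => w p.1 p.2) := fun z =>
    IsBoundedUnder.isCoboundedUnder_le
      ⟨-(B z + 1), eventually_map.2 <| (key z _ (lt_add_one _)).mono fun p h => (abs_le.1 h).1⟩
  refine ⟨fun z => limsup (fun p : ι × ℝ => w p.1 p.2) (l ×ˢ 𝓝 z),
    ⟨fun z c h => eventually_lt_of_limsup_lt h (hbdd z),
      fun z c h => frequently_lt_of_lt_limsup (hcob z) h⟩, fun z => ?_⟩
  refine le_of_forall_gt_imp_ge_of_dense fun c hc => abs_le.2 ⟨?_, ?_⟩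
  · exact le_limsup_of_frequently_le
      ((key z c hc).mono fun p h => (abs_le.1 h).1).frequently (hbdd z)
  · exact limsup_le_of_le (hcob z) ((key z c hc).mono fun p h => (abs_le.1 h).2)

namespace IsUpperRelaxedLimit

variable {ι : Type*} {l : Filter ι} {w : ι → ℝ → ℝ} {W : ℝ → ℝ}

theorem upperSemicontinuous (h : IsUpperRelaxedLimit l w W) : UpperSemicontinuous W := by
  intro z c hc
  obtain ⟨d, hzd, hdc⟩ := exists_between hc
  obtain ⟨P, hP, Q, hQ, hPQ⟩ := eventually_prod_iff.1 (h.eventually_lt z d hzd)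
  filter_upwards [eventually_eventually_nhds.2 hQ] with y hy
  refine lt_of_le_of_lt (not_lt.1 fun hdy => ?_) hdc
  obtain ⟨p, hp, hp'⟩ := ((h.frequently_lt y d hdy).and_eventually (hP.prod_mk hy)).exists
  exact lt_asymm hp (hPQ hp'.1 hp'.2)

/-- Strict maxima of an upper half-relaxed limit are approximated by local maxima of the family. -/
theorem frequently_isLocalMax (h : IsUpperRelaxedLimit l w W)
    (hw : ∀ᶠ i in l, UpperSemicontinuous (w i)) {f : ℝ → ℝ} (hf : Continuous f) {z : ℝ}
    (hz : IsLocalMax (fun y => W y - f y) z) :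
    ∃ᶠ p in (l ×ˢ 𝓝 z) ⊓ comap (fun p : ι × ℝ => w p.1 p.2) (𝓝 (W z)),
      IsLocalMax (fun y => w p.1 y - (f y + (y - z) ^ 4)) p.2 := by
  -- The quartic makes the maximum strict and leaves the first two derivatives at `z` unchanged.
  set g : ℝ → ℝ := fun y => f y + (y - z) ^ 4 with hg
  have hgc : Continuous g := by fun_prop
  have hgz : g z = f z := by simp [hg]
  have hball : ∀ ε > 0, ∃ᶠ i in l, ∃ y, |y - z| < ε ∧ |w i y - W z| < ε ∧
      IsLocalMax (fun y => w i y - g y) y := by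
    intro ε hε
    obtain ⟨a, ha, hga⟩ := Metric.continuousAt_iff.1 hgc.continuousAt (ε / 2) (half_pos hε)
    obtain ⟨b, hb, hzb⟩ := Metric.eventually_nhds_iff.1 hz
    obtain ⟨R, hR, hRa⟩ : ∃ R > 0, R < a ∧ R < b ∧ R < ε := by
      obtain ⟨R, h0, h1⟩ := exists_between (lt_min ha (lt_min hb hε))
      exact ⟨R, h0, by simpa using h1⟩
    obtain ⟨hRa, hRb, hRε⟩ := hRa
    have hmax : ∀ y, |y - z| ≤ R → W y - f y ≤ W z - f z := fun y hy =>
      hzb (by rw [Real.dist_eq]; linarith)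
    -- `η < (R / 2) ^ 4` makes the quartic push the outer annulus below the near-maximal level; `η <
    -- ε / 2` controls the value at the maximiser.
    obtain ⟨η, hη, hη1⟩ := exists_between (lt_min (half_pos hε) (show 0 < (R / 2) ^ 4 by positivity))
    obtain ⟨hη1, hη2⟩ := lt_min_iff.1 hη1
    have hloc : ∀ y c, W y - g y < c → ∀ᶠ p in l ×ˢ 𝓝 y, w p.1 p.2 - g p.2 < c := by
      intro y c hc
      obtain ⟨d, hd, hdc⟩ := exists_between (show W y < c + g y by linarith)
      filter_upwards [h.eventually_lt y d hd, tendsto_snd.eventually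
        (hgc.continuousAt.eventually_const_lt (show d - c < g y by linarith))] with p h1 h2
      linarith
    have hcompact : ∀ K : Set ℝ, IsCompact K → ∀ c, (∀ y ∈ K, W y - g y < c) →
        ∀ᶠ i in l, ∀ y ∈ K, w i y - g y < c := by
      intro K hK c hc
      refine hK.induction_on (p := fun K => ∀ᶠ i in l, ∀ y ∈ K, w i y - g y < c)
        (by simp) (fun s t hst ht => ht.mono fun i hi y hy => hi y (hst hy))
        (fun s t hs ht => ?_) (fun y hy => ?_)
      · filter_upwards [hs, ht] with i h1 h2 y hy
        exact hy.elim (h1 y) (h2 y)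
      · obtain ⟨P, hP, Q, hQ, hPQ⟩ := eventually_prod_iff.1 (hloc y c (hc y hy))
        exact ⟨{x | Q x}, mem_nhdsWithin_of_mem_nhds hQ, hP.mono fun i hi x hx => hPQ hi hx⟩
    have hcb : IsCompact (Metric.closedBall z R) := isCompact_closedBall z R
    have hupper := hcompact _ hcb (W z - g z + η) fun y hy => by
      have h1 := hmax y (by simpa [Real.dist_eq] using hy)
      have h2 : 0 ≤ (y - z) ^ 4 := by positivity
      simp only [hg, sub_self]; linarith
    have hann := hcompact _ (hcb.diff (Metric.isOpen_ball (x := z) (ε := R / 2)))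
        (W z - g z - η) fun y hy => by
      have h1 := hmax y (by simpa [Real.dist_eq] using hy.1)
      have h2 : R / 2 ≤ |y - z| := by simpa [Real.dist_eq] using hy.2
      have h3 : (R / 2) ^ 4 ≤ (y - z) ^ 4 := by
        rw [← Even.pow_abs (by decide : Even 4) (y - z)]
        gcongr
      simp only [hg, sub_self]; linarith
    have hlow : ∃ᶠ i in l, ∃ y ∈ Metric.closedBall z R, W z - g z - η < w i y - g y := by
      intro hcon
      obtain ⟨d, hd, hd'⟩ := exists_between (show W z - η < W z by linarith)
      refine h.frequently_lt z d hd' ?_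
      filter_upwards [tendsto_fst.eventually hcon, tendsto_snd.eventually
        (Metric.closedBall_mem_nhds z hR), tendsto_snd.eventually
        (hgc.continuousAt.eventually_lt_const (show g z < d - W z + η + g z by linarith))]
        with p h1 h2 h3 h4
      exact h1 ⟨p.2, h2, by linarith⟩
    refine (hlow.and_eventually (hupper.and (hann.and hw))).mono ?_
    rintro i ⟨⟨y₀, hy₀, hwy₀⟩, hup, han, husc⟩
    have husc' : UpperSemicontinuousOn (fun y => w i y - g y) (Metric.closedBall z R) := by
      have := (husc.add (hgc.neg.upperSemicontinuous)).upperSemicontinuousOn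
        (Metric.closedBall z R)
      simpa [sub_eq_add_neg] using this
    obtain ⟨y, hy, hymax⟩ := husc'.exists_isMaxOn ⟨y₀, hy₀⟩ hcb
    have hyl : W z - g z - η < w i y - g y := hwy₀.trans_le (hymax hy₀)
    -- The maximiser over the closed ball avoids the annulus, so it is interior and hence a local
    -- maximum.
    have hyb : y ∈ Metric.ball z (R / 2) := by
      by_contra hn
      exact lt_asymm hyl (han y ⟨hy, hn⟩)
    have hyR : |y - z| < R / 2 := by simpa [Real.dist_eq] using hyb
    have hyu := hup y hy
    have hgy := hga (show dist y z < a by rw [Real.dist_eq]; linarith)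
    rw [Real.dist_eq, abs_lt] at hgy
    refine ⟨y, by linarith, abs_lt.2 ⟨by linarith, by linarith⟩, ?_⟩
    exact hymax.isLocalMax (mem_of_superset (Metric.isOpen_ball.mem_nhds hyb)
      (Metric.ball_subset_closedBall.trans (Metric.closedBall_subset_closedBall (by linarith))))
  rw [frequently_iff]
  intro U hU
  obtain ⟨S, hS, T, hT, rfl⟩ := mem_inf_iff.1 hU
  obtain ⟨P, hP, Q, hQ, hPQ⟩ := eventually_prod_iff.1 (show ∀ᶠ p in l ×ˢ 𝓝 z, p ∈ S from hS)
  obtain ⟨T', hT', hTT⟩ := mem_comap.1 hT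
  obtain ⟨a, ha, hQa⟩ := Metric.eventually_nhds_iff.1 hQ
  obtain ⟨b, hb, hTb⟩ := Metric.mem_nhds_iff.1 hT'
  obtain ⟨i, ⟨y, h1, h2, h3⟩, hi⟩ := ((hball (min a b) (lt_min ha hb)).and_eventually hP).exists
  refine ⟨(i, y), ⟨hPQ hi (hQa ?_), hTT (hTb ?_)⟩, h3⟩
  · rw [Real.dist_eq]; exact h1.trans_le (min_le_left _ _)
  · rw [Metric.mem_ball, Real.dist_eq]; exact h2.trans_le (min_le_right _ _)

end IsUpperRelaxedLimit

/-! ### Envelopes of the running cost, generator, and closing the window -/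

namespace ClockModel

variable (P : ClockModel)

theorem k_lamBar_nonneg : 0 ≤ P.k P.lamBar := by
  simpa [P.k_zero] using P.k_mono (Set.left_mem_Icc.2 P.lamBar_pos.le)
    (Set.right_mem_Icc.2 P.lamBar_pos.le) P.lamBar_pos.le

theorem clockCost_nonneg (δ z : ℝ) : 0 ≤ P.clockCost δ z := by
  unfold clockCost silencePolicy
  split_ifs
  exacts [P.k_zero.ge, P.k_lamBar_nonneg]

theorem clockCost_le (δ z : ℝ) : P.clockCost δ z ≤ P.k P.lamBar := by
  unfold clockCost silencePolicy
  split_ifs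
  exacts [P.k_zero.le.trans P.k_lamBar_nonneg, le_rfl]

theorem clockCost_of_lt {δ z : ℝ} (h : δ < |z - P.zHat|) : P.clockCost δ z = P.k P.lamBar := by
  simp [clockCost, silencePolicy, h.not_ge]

theorem isBoundedUnder_ge_clockCost (δ z : ℝ) :
    IsBoundedUnder (· ≥ ·) (𝓝 z) (P.clockCost δ) :=
  isBoundedUnder_of ⟨0, P.clockCost_nonneg δ⟩

theorem isBoundedUnder_le_clockCost (δ z : ℝ) :
    IsBoundedUnder (· ≤ ·) (𝓝 z) (P.clockCost δ) :=
  isBoundedUnder_of ⟨_, P.clockCost_le δ⟩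

theorem lowerEnvelope_clockCost_nonneg (δ z : ℝ) : 0 ≤ lowerEnvelope (P.clockCost δ) z :=
  le_liminf_of_le (P.isBoundedUnder_le_clockCost δ z).isCoboundedUnder_ge
    (Eventually.of_forall (P.clockCost_nonneg δ))

theorem lowerEnvelope_clockCost_le (δ z : ℝ) :
    lowerEnvelope (P.clockCost δ) z ≤ P.clockCost δ z :=
  liminf_le_of_frequently_le (frequently_iff.2 fun hU => ⟨z, mem_of_mem_nhds hU, le_rfl⟩)
    (P.isBoundedUnder_ge_clockCost δ z)

theorem upperEnvelope_clockCost_le (δ z : ℝ) :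
    upperEnvelope (P.clockCost δ) z ≤ P.k P.lamBar :=
  limsup_le_of_le (P.isBoundedUnder_ge_clockCost δ z).isCoboundedUnder_le
    (Eventually.of_forall (P.clockCost_le δ))

theorem lowerEnvelope_clockCost_of_lt {δ z : ℝ} (h : δ < |z - P.zHat|) :
    P.k P.lamBar ≤ lowerEnvelope (P.clockCost δ) z := by
  refine le_liminf_of_le (P.isBoundedUnder_le_clockCost δ z).isCoboundedUnder_ge ?_
  have hc : ContinuousAt (fun y => |y - P.zHat|) z := by fun_prop
  filter_upwards [hc.eventually_const_lt h] with y hy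
  exact (P.clockCost_of_lt hy).ge

/-- The vanished window is invisible to the upper envelope of the running cost. -/
theorem upperEnvelope_clockCost_zero (z : ℝ) :
    P.k P.lamBar ≤ upperEnvelope (P.clockCost 0) z := by
  refine le_limsup_of_frequently_le ?_ (P.isBoundedUnder_le_clockCost 0 z)
  refine (mem_closure_iff_frequently.1 (dense_compl_singleton P.zHat z)).mono fun y hy => ?_
  exact (P.clockCost_of_lt (abs_pos.2 (sub_ne_zero.2 hy))).ge

/-- At `ẑ` the limit cost is already minimal, namely `0`; away from `ẑ`, small windows miss a whole
neighbourhood and the cost there is `k(λ̄)`. -/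
theorem eventually_lowerEnvelope_clockCost_le (z : ℝ) :
    ∀ᶠ p in 𝓝[>] (0 : ℝ) ×ˢ 𝓝 z,
      lowerEnvelope (P.clockCost 0) z ≤ lowerEnvelope (P.clockCost p.1) p.2 := by
  rcases eq_or_ne z P.zHat with rfl | hz
  · refine Eventually.of_forall fun p => le_trans ?_ (P.lowerEnvelope_clockCost_nonneg _ _)
    exact (P.lowerEnvelope_clockCost_le 0 _).trans (by simp [clockCost, silencePolicy, P.k_zero])
  · have h1 : Tendsto (fun p : ℝ × ℝ => p.1) (𝓝[>] (0 : ℝ) ×ˢ 𝓝 z) (𝓝 0) :=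
      tendsto_fst.mono_right nhdsWithin_le_nhds
    have h2 : Tendsto (fun p : ℝ × ℝ => |p.2 - P.zHat|) (𝓝[>] (0 : ℝ) ×ˢ 𝓝 z)
        (𝓝 |z - P.zHat|) := (tendsto_snd.sub_const _).abs
    filter_upwards [h1.eventually_lt h2 (abs_pos.2 (sub_ne_zero.2 hz))] with p hp
    exact ((P.lowerEnvelope_clockCost_le 0 z).trans (P.clockCost_le 0 z)).trans
      (P.lowerEnvelope_clockCost_of_lt hp)

theorem continuous_generator {f : ℝ → ℝ} (hf : ContDiff ℝ 2 f) : Continuous (P.generator f) := by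
  have h1 : ContDiff ℝ 1 (deriv f) := ((contDiff_succ_iff_deriv (n := 1)).1 hf).2.2
  have h2 : Continuous (deriv (deriv f)) := h1.continuous_deriv le_rfl
  have h3 := h1.continuous
  have h4 := P.μ_lip.continuous
  have h5 := P.φ_lip.continuous
  unfold generator
  fun_prop

/-- A quartic perturbation does not change the generator at its centre. -/
theorem generator_add_quartic {f : ℝ → ℝ} (hf : ContDiff ℝ 2 f) (a z : ℝ) :
    P.generator (fun y => f y + a * (y - z) ^ 4) z = P.generator f z := by
  have h1 : deriv (fun y => f y + a * (y - z) ^ 4) = fun y => deriv f y + 4 * a * (y - z) ^ 3 := by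
    ext y
    have hq := (((hasDerivAt_id y).sub_const z).pow 4).const_mul a
    have := ((hf.differentiable (by norm_num) y).hasDerivAt.add hq).deriv
    simp only [id] at this
    refine Eq.trans this ?_
    push_cast; ring
  have hd : ContDiff ℝ 1 (deriv f) := ((contDiff_succ_iff_deriv (n := 1)).1 hf).2.2
  have h2 : deriv (fun y => deriv f y + 4 * a * (y - z) ^ 3) z = deriv (deriv f) z := by
    have hq := (((hasDerivAt_id z).sub_const z).pow 3).const_mul (4 * a)
    have := ((hd.differentiable (by norm_num) z).hasDerivAt.add hq).deriv
    simp only [id] at this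
    refine Eq.trans this ?_
    simp
  simp only [generator, h1, h2]
  ring

variable {P}

/-- The supersolution property survives the closing of the silence window. -/
theorem IsViscositySupersolution.zero {δ : ℝ} {v : ℝ → ℝ} (h : P.IsViscositySupersolution δ v) :
    P.IsViscositySupersolution 0 v := by
  refine ⟨h.lsc, fun f hf z hz => ?_⟩
  obtain ⟨h1, h2⟩ := le_min_iff.1 (h.ineq f hf z hz)
  have := P.upperEnvelope_clockCost_le δ z
  have := P.upperEnvelope_clockCost_zero z
  exact le_min (by linarith) h2

/-- The subsolution property survives the closing of the silence window, up to the discounted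
cost of a clock that always runs. -/
theorem IsViscositySubsolution.sub_const {δ : ℝ} {u : ℝ → ℝ} (h : P.IsViscositySubsolution δ u) :
    P.IsViscositySubsolution 0 (fun y => u y - P.k P.lamBar / P.r) := by
  set c := P.k P.lamBar / P.r with hc
  -- Lowering `u` by `c` lowers `r u` by `k(λ̄)`, the largest possible gap between the two cost
  -- envelopes.
  have hrc : P.r * c = P.k P.lamBar := by rw [hc]; field_simp [P.r_pos.ne']
  refine ⟨?_, fun f hf z hz => ?_⟩
  · have := h.usc.add (continuous_const (y := -c)).upperSemicontinuous
    simpa [sub_eq_add_neg] using this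
  · have hz' : IsLocalMax (fun y => u y - f y) z := by
      filter_upwards [hz] with y hy
      linarith
    have h0 := (P.lowerEnvelope_clockCost_le 0 z).trans (P.clockCost_le 0 z)
    have h1 := P.lowerEnvelope_clockCost_nonneg δ z
    rcases min_le_iff.1 (h.ineq f hf z hz') with h2 | h2
    · exact min_le_of_left_le (by nlinarith)
    · refine min_le_of_right_le ?_
      have : P.impulse (fun y => u y - c) z = P.impulse u z - c := by
        simp only [impulse, ← max_sub_sub_right]
        congr 1 <;> ring
      linarith

/-! ### Stability under half-relaxed limits -/

variable {V : ℝ → ℝ → ℝ}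

/-- If both entries of the minimum were positive at `z`, they would stay positive at nearby contact
points of `V δ`. The impulse term is nonlocal but sees only the two reset targets, so eventual upper
bounds there suffice. -/
theorem isViscositySubsolution_of_relaxedLimit {u : ℝ → ℝ}
    (hV : ∀ᶠ δ in 𝓝[>] (0 : ℝ), P.IsViscositySubsolution δ (V δ))
    (hu : IsUpperRelaxedLimit (𝓝[>] (0 : ℝ)) V u) : P.IsViscositySubsolution 0 u := by
  refine ⟨hu.upperSemicontinuous, fun f hf z hz => ?_⟩
  by_contra! hcon
  obtain ⟨hA, hM⟩ := lt_min_iff.1 hcon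
  set g : ℝ → ℝ := fun y => f y + 1 * (y - z) ^ 4 with hg
  have hgC : ContDiff ℝ 2 g := by fun_prop
  have hgen : P.generator g z = P.generator f z := P.generator_add_quartic hf 1 z
  have hfr := hu.frequently_isLocalMax (hV.mono fun δ h => h.usc) hf.continuous hz
  set F := (𝓝[>] (0 : ℝ) ×ˢ 𝓝 z) ⊓ comap (fun p : ℝ × ℝ => V p.1 p.2) (𝓝 (u z)) with hF
  have hF1 : F ≤ 𝓝[>] (0 : ℝ) ×ˢ 𝓝 z := inf_le_left
  have hδ : Tendsto Prod.fst F (𝓝[>] (0 : ℝ)) := tendsto_fst.mono_left hF1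
  have hy : Tendsto Prod.snd F (𝓝 z) := tendsto_snd.mono_left hF1
  have hVt : Tendsto (fun p : ℝ × ℝ => V p.1 p.2) F (𝓝 (u z)) := tendsto_comap.mono_left inf_le_right
  have hpt : ∀ x c, u x < c → ∀ᶠ δ in 𝓝[>] (0 : ℝ), V δ x < c := fun x c hc =>
    (hu.eventually_lt x c hc).curry.mono fun δ h => h.self_of_nhds
  -- The level `m` separates the impulse value of `u` from `u z`.
  obtain ⟨m, hm1, hm2⟩ := exists_between (sub_pos.1 hM)
  obtain ⟨hm1, hm1'⟩ := max_lt_iff.1 hm1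
  have hE : Tendsto (fun p : ℝ × ℝ => P.r * V p.1 p.2 - P.generator g p.2 - P.π p.2 +
      lowerEnvelope (P.clockCost 0) z) F
      (𝓝 (P.r * u z - P.generator f z - P.π z + lowerEnvelope (P.clockCost 0) z)) := by
    rw [← hgen]
    exact (((hVt.const_mul _).sub (((P.continuous_generator hgC).tendsto z).comp hy)).sub
      ((P.π_cont.tendsto z).comp hy)).add_const _
  obtain ⟨p, hp, hsub, hEp, hlow, hVm, h1, h2⟩ := (hfr.and_eventually ((hδ.eventually hV).and
    ((hE.eventually_const_lt hA).and (((P.eventually_lowerEnvelope_clockCost_le z).filter_mono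
    hF1).and ((hVt.eventually_const_lt hm2).and ((hδ.eventually (hpt P.z₁ (m + P.K₁)
    (by linarith))).and (hδ.eventually (hpt P.z₂ (m + P.K₂) (by linarith))))))))).exists
  rcases min_le_iff.1 (hsub.ineq g hgC p.2 (by simpa [hg] using hp)) with h | h
  · linarith
  · have : P.impulse (V p.1) p.2 < m := max_lt (by linarith) (by linarith)
    linarith

theorem isViscositySupersolution_of_relaxedLimit {v : ℝ → ℝ}
    (hV : ∀ᶠ δ in 𝓝[>] (0 : ℝ), P.IsViscositySupersolution δ (V δ))
    (hv : IsUpperRelaxedLimit (𝓝[>] (0 : ℝ)) (fun δ y => -V δ y) (fun y => -v y)) :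
    P.IsViscositySupersolution 0 v := by
  refine ⟨by simpa only [Pi.neg_def, neg_neg] using hv.upperSemicontinuous.neg, fun f hf z hz => ?_⟩
  set g : ℝ → ℝ := fun y => f y + (-1) * (y - z) ^ 4 with hg
  have hgC : ContDiff ℝ 2 g := by fun_prop
  have hgen : P.generator g z = P.generator f z := P.generator_add_quartic hf (-1) z
  have hfr := hv.frequently_isLocalMax (f := fun y => -f y) (z := z)
    (hV.mono fun δ h => h.lsc.neg) hf.continuous.neg
    (by filter_upwards [hz] with y hy; linarith)
  set F := (𝓝[>] (0 : ℝ) ×ˢ 𝓝 z) ⊓ comap (fun p : ℝ × ℝ => -V p.1 p.2) (𝓝 (-v z)) with hF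
  have hF1 : F ≤ 𝓝[>] (0 : ℝ) ×ˢ 𝓝 z := inf_le_left
  have hδ : Tendsto Prod.fst F (𝓝[>] (0 : ℝ)) := tendsto_fst.mono_left hF1
  have hy : Tendsto Prod.snd F (𝓝 z) := tendsto_snd.mono_left hF1
  have hVt : Tendsto (fun p : ℝ × ℝ => V p.1 p.2) F (𝓝 (v z)) := by
    have : Tendsto (fun p : ℝ × ℝ => -V p.1 p.2) F (𝓝 (-v z)) :=
      tendsto_comap.mono_left inf_le_right
    simpa using this.neg
  have hpt : ∀ x c, c < v x → ∀ᶠ δ in 𝓝[>] (0 : ℝ), c < V δ x := fun x c hc =>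
    (hv.eventually_lt x (-c) (neg_lt_neg hc)).curry.mono fun δ h => neg_lt_neg_iff.1 h.self_of_nhds
  have hE : Tendsto (fun p : ℝ × ℝ => P.r * V p.1 p.2 - P.generator g p.2 - P.π p.2 +
      upperEnvelope (P.clockCost 0) z) F
      (𝓝 (P.r * v z - P.generator f z - P.π z + upperEnvelope (P.clockCost 0) z)) := by
    rw [← hgen]
    exact (((hVt.const_mul _).sub (((P.continuous_generator hgC).tendsto z).comp hy)).sub
      ((P.π_cont.tendsto z).comp hy)).add_const _
  have hfr' : ∃ᶠ p in F, 0 ≤ P.r * V p.1 p.2 - P.generator g p.2 - P.π p.2 +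
      upperEnvelope (P.clockCost 0) z ∧ P.impulse (V p.1) p.2 ≤ V p.1 p.2 := by
    refine (hfr.and_eventually (hδ.eventually hV)).mono fun p hp => ?_
    have hmin : IsLocalMin (fun y => V p.1 y - g y) p.2 := by
      filter_upwards [hp.1] with y hy
      simp only [hg]
      linarith
    obtain ⟨h1, h2⟩ := le_min_iff.1 (hp.2.ineq g hgC p.2 hmin)
    -- Every cost envelope is at most `k(λ̄)`, which the limit envelope attains even at `ẑ`.
    have := P.upperEnvelope_clockCost_le p.1 p.2
    have := P.upperEnvelope_clockCost_zero z
    exact ⟨by linarith, by linarith⟩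
  refine le_min ?_ (sub_nonneg.2 ?_)
  · by_contra! hneg
    obtain ⟨p, hp, hp'⟩ := (hfr'.and_eventually (hE.eventually_lt_const hneg)).exists
    linarith [hp.1]
  · by_contra! hneg
    obtain ⟨m, hm1, hm2⟩ := exists_between hneg
    have hI : ∀ᶠ δ in 𝓝[>] (0 : ℝ), ∀ y, m < P.impulse (V δ) y := by
      rcases lt_max_iff.1 hm2 with h | h
      · filter_upwards [hpt P.z₁ (m + P.K₁) (by linarith)] with δ h y
        exact lt_max_of_lt_left (by linarith)
      · filter_upwards [hpt P.z₂ (m + P.K₂) (by linarith)] with δ h y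
        exact lt_max_of_lt_right (by linarith)
    obtain ⟨p, hp, h1, h2⟩ := (hfr'.and_eventually
      ((hVt.eventually_lt_const hm1).and (hδ.eventually hI))).exists
    linarith [hp.2, h2 p.2]

end ClockModel

/-! ### Uniform bound, convergence and conclusion -/

theorem HasExpGrowth.sub_const {ρ : ℝ} (hρ : 0 ≤ ρ) {u : ℝ → ℝ} (hu : HasExpGrowth ρ u) (c : ℝ) :
    HasExpGrowth ρ (fun y => u y - c) := by
  obtain ⟨C, hC⟩ := hu
  refine ⟨C + |c|, fun z => ?_⟩
  have h1 : 1 ≤ Real.exp (ρ * |z|) := Real.one_le_exp (by positivity)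
  nlinarith [abs_sub (u z) c, hC z, abs_nonneg c]

/-- Solutions for small windows are bounded uniformly in the window, by the comparison principle
of the limit problem. -/
theorem ClockModel.exists_uniform_bound {P : ClockModel} {ρ : ℝ} (hρ : 0 ≤ ρ) {V : ℝ → ℝ → ℝ}
    (hV : ∀ᶠ δ in 𝓝[>] (0 : ℝ), P.IsViscositySolution δ (V δ) ∧ HasExpGrowth ρ (V δ))
    (hcomp : P.ComparisonPrinciple 0 ρ) :
    ∃ C, ∀ᶠ δ in 𝓝[>] (0 : ℝ), ∀ y, |V δ y| ≤ C * Real.exp (ρ * |y|) := by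
  -- One reference solution, compared from both sides, bounds all the others.
  obtain ⟨δ₀, h0, h0g⟩ := hV.exists
  have hcomp' : ∀ {a b : ℝ}, P.IsViscositySolution a (V a) → HasExpGrowth ρ (V a) →
      P.IsViscositySolution b (V b) → HasExpGrowth ρ (V b) →
      ∀ y, V a y - P.k P.lamBar / P.r ≤ V b y := fun ha hag hb hbg =>
    hcomp _ _ ha.1.sub_const (hag.sub_const hρ _) hb.2.zero hbg
  obtain ⟨C, hC⟩ := h0g
  have hκ : 0 ≤ P.k P.lamBar / P.r := div_nonneg P.k_lamBar_nonneg P.r_pos.le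
  refine ⟨C + P.k P.lamBar / P.r, hV.mono fun δ hδ y => ?_⟩
  have h1 := hcomp' h0 ⟨C, hC⟩ hδ.1 hδ.2 y
  have h2 := hcomp' hδ.1 hδ.2 h0 ⟨C, hC⟩ y
  have h3 : 1 ≤ Real.exp (ρ * |y|) := Real.one_le_exp (by positivity)
  have h4 := abs_le.1 (hC y)
  rw [add_mul]
  exact abs_le.2 ⟨by nlinarith, by nlinarith⟩

/-- When both half-relaxed limits equal `W`, it is semicontinuous from both sides, hence continuous;
the joint bounds near `x` against `W x` then become bounds against `W y`. -/
theorem IsUpperRelaxedLimit.tendstoLocallyUniformly {ι : Type*} {l : Filter ι} {w : ι → ℝ → ℝ}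
    {W : ℝ → ℝ} (hu : IsUpperRelaxedLimit l w W)
    (hv : IsUpperRelaxedLimit l (fun i y => -w i y) (fun y => -W y)) :
    TendstoLocallyUniformly w W l := by
  rw [Metric.tendstoLocallyUniformly_iff]
  intro ε hε x
  have hlsc : LowerSemicontinuous W := by simpa only [Pi.neg_def, neg_neg] using hv.upperSemicontinuous.neg
  obtain ⟨A, hA, B, hB, hAB⟩ := eventually_prod_iff.1
    ((hu.eventually_lt x (W x + ε / 2) (by linarith)).and
      (hv.eventually_lt x (-W x + ε / 2) (by linarith)))
  refine ⟨{y | B y ∧ W y < W x + ε / 2 ∧ W x - ε / 2 < W y}, ?_, hA.mono fun i hi y hy => ?_⟩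
  · exact hB.and ((hu.upperSemicontinuous x _ (by linarith)).and (hlsc x _ (by linarith)))
  · obtain ⟨h1, h2⟩ := hAB hi hy.1
    rw [Real.dist_eq, abs_lt]
    constructor <;> linarith [hy.2.1, hy.2.2]

theorem IsUpperRelaxedLimit.neg_le {ι : Type*} {l : Filter ι} [l.NeBot] {w : ι → ℝ → ℝ}
    {u v : ℝ → ℝ} (hu : IsUpperRelaxedLimit l w u)
    (hv : IsUpperRelaxedLimit l (fun i y => -w i y) v) (z : ℝ) : -v z ≤ u z := by
  by_contra! h
  obtain ⟨m, h1, h2⟩ := exists_between h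
  obtain ⟨p, h3, h4⟩ :=
    ((hu.eventually_lt z m h1).and (hv.eventually_lt z (-m) (by linarith))).exists
  linarith

theorem mainTheorem10 (P : ClockModel) (ρ : ℝ) (hρ : 0 ≤ ρ)
    (V : ℝ → ℝ → ℝ)
    (hV : ∀ᶠ δ in 𝓝[>] (0 : ℝ), P.IsViscositySolution δ (V δ) ∧ HasExpGrowth ρ (V δ))
    (hcomp : P.ComparisonPrinciple 0 ρ) :
    ∃ V₀ : ℝ → ℝ,
      TendstoLocallyUniformly V V₀ (𝓝[>] (0 : ℝ)) ∧
      (P.IsViscositySolution 0 V₀ ∧ HasExpGrowth ρ V₀) ∧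
      ∀ W : ℝ → ℝ, P.IsViscositySolution 0 W → HasExpGrowth ρ W → W = V₀ := by
  obtain ⟨C, hC⟩ := ClockModel.exists_uniform_bound hρ hV hcomp
  have hB : Continuous fun y : ℝ => C * Real.exp (ρ * |y|) := by fun_prop
  obtain ⟨u, hu, hub⟩ := exists_isUpperRelaxedLimit hB hC
  obtain ⟨v, hv, hvb⟩ := exists_isUpperRelaxedLimit (w := fun δ y => -V δ y) hB
    (by simpa only [abs_neg] using hC)
  have hsub : P.IsViscositySubsolution 0 u :=
    ClockModel.isViscositySubsolution_of_relaxedLimit (hV.mono fun δ h => h.1.1) hu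
  have hsup : P.IsViscositySupersolution 0 (fun y => -v y) :=
    ClockModel.isViscositySupersolution_of_relaxedLimit (hV.mono fun δ h => h.1.2) (by simpa using hv)
  have heq : (fun y => -v y) = u := funext fun z => le_antisymm (hu.neg_le hv z)
    (hcomp _ _ hsub ⟨C, hub⟩ hsup ⟨C, by simpa only [abs_neg] using hvb⟩ z)
  have heq' : v = fun y => -u y := by rw [← heq]; simp
  rw [heq] at hsup
  rw [heq'] at hv
  exact ⟨u, hu.tendstoLocallyUniformly hv, ⟨⟨hsub, hsup⟩, ⟨C, hub⟩⟩, fun W hW hWg => funext fun z =>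
    le_antisymm (hcomp _ _ hW.1 hWg hsup ⟨C, hub⟩ z) (hcomp _ _ hsub ⟨C, hub⟩ hW.2 hWg z)⟩
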